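/- Let $R$ be a commutative Noetherian ring and let $M$ be a finitely generated $R$-module. For an $R$-module $N$, let $\operatorname{Ass}(N)$ be the set of prime ideals of $R$ that are annihilators of elements of $N$; for $\mathfrak p\in\operatorname{Spec}(R)$, call $N$ *$\mathfrak p$-coprimary* if $\operatorname{Ass}(N)=\{\mathfrak p\}$. Fix a linear order $\le$ on $\operatorname{Spec}(R)$ that extends inclusion, i.e. $\mathfrak p\subseteq\mathfrak q$ implies $\mathfrak p\le\mathfrak q$. Then there is a unique finite filtration of $M$ by submodules $$0=M_0\subsetneq M_1\subsetneq\cdots\subsetneq M_n=M\qquad(n\ge 0)$$ for which there are primes $\mathfrak p_0,\dots,\mathfrak p_{n-1}$ of $R$ such that $M_{i+1}/M_i$ is $\mathfrak p_i$-coprimary for each $0\le i<n$ and $\mathfrak p_0>\mathfrak p_1>\cdots>\mathfrak p_{n-1}$. (Both the length $n$ and the submodules $M_i$ are unique.) Moreover, for this filtration and these primes, $$\operatorname{Ass}(M)=\{\mathfrak p_0,\dots,\mathfrak p_{n-1}\}.$$ -/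

import Mathlib

/-- `N` is a `𝔭`-coprimary `R`-module: `Ass(N)` consists of the single prime `𝔭`.
(Over a Noetherian ring, Mathlib's `associatedPrimes R N` is the set of the prime ideals of the
form `Ann(x)` with `x ∈ N`, see `isAssociatedPrime_iff`.) -/
def IsCoprimaryModule (R : Type*) [CommRing R] (N : Type*) [AddCommGroup N] [Module R N]
    (𝔭 : PrimeSpectrum R) : Prop :=
  associatedPrimes R N = {𝔭.asIdeal}

/-- The strictly increasing chain `s 0 ⊊ s 1 ⊊ ⋯ ⊊ s n` of submodules of `M` (`n = s.length`) is
a coprimary filtration of `M` with primes `𝔭 0, …, 𝔭 (n - 1)`, with respect to the linear order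
`o` on `Spec R`: it starts at `0` and ends at `M`, each quotient `s (i + 1) / s i` is
`𝔭 i`-coprimary, and `𝔭 0 > ⋯ > 𝔭 (n - 1)` for the order `o`. -/
structure IsCoprimaryFiltration {R : Type*} [CommRing R] {M : Type*} [AddCommGroup M]
    [Module R M] (o : LinearOrder (PrimeSpectrum R)) (s : LTSeries (Submodule R M))
    (𝔭 : Fin s.length → PrimeSpectrum R) : Prop where
  head_eq_bot : s.head = ⊥
  last_eq_top : s.last = ⊤
  coprimary : ∀ i : Fin s.length,
    IsCoprimaryModule R
      (↥(s i.succ) ⧸ (s i.castSucc).submoduleOf (s i.succ)) (𝔭 i)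
  strictAnti : ∀ i j : Fin s.length, i < j → o.lt (𝔭 j) (𝔭 i)

/-!
For a set `U` of primes, let `Γ_U(M)` be the submodule of the elements of `M` that vanish in the
localization `M_𝔮` for every prime `𝔮 ∉ U`. If `U` is stable under specialization and `R` is
Noetherian, then `Γ_U` splits the associated primes of `M` exactly:
`Ass(Γ_U(M)) = Ass(M) ∩ U` and `Ass(M / Γ_U(M)) = Ass(M) \ U`
(`mem_associatedPrimes_supportedOn` and `mem_associatedPrimes_quotient_supportedOn`). Conversely
`Γ_U(M)` is the only submodule `N` with `Ass(N) ⊆ U` and `Ass(M / N) ∩ U = ∅`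
(`eq_supportedOn`).

A coprimary filtration with primes `𝔭 0 > ⋯ > 𝔭 (n - 1)` satisfies `Ass(M i) ⊆ {𝔭 j | j < i}` and
`Ass(M / M i) ⊆ {𝔭 j | i ≤ j}`, by the exact sequences of its successive quotients. Let `U i` be
the set of the primes that are `≥ 𝔭 j`, in the given linear order, for some `j < i`. It is stable
under specialization because the order extends inclusion, and it separates these two sets of
primes, so `M i = Γ_{U i}(M)` (`IsCoprimaryFiltration.eq_supportedOn`). The splitting of `Ass` then
shows that the `𝔭 i` are precisely the associated primes of `M`. They are therefore determined by
`M`, being its finitely many associated primes in decreasing order, and hence so is the filtration.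
For existence, enumerate `Ass(M)` in decreasing order and define `M i` as `Γ_{U i}(M)`.
-/

/-! ### Elements supported on a set of primes -/

section SupportedOn

variable {R : Type*} [CommRing R] {M : Type*} [AddCommGroup M] [Module R M]

variable (M) in
/-- The submodule `Γ_U(M)` of the elements whose support is contained in `U`: those that are killed,
for each prime `𝔮 ∉ U`, by some element outside `𝔮`. This makes sense for every set `U` of primes,
but is mostly of interest when `U` is stable under specialization, i.e. an upper set. -/
def supportedOn (U : Set (PrimeSpectrum R)) : Submodule R M where
  carrier := {x | ∀ 𝔮 ∉ U, ∃ r ∉ 𝔮.asIdeal, r • x = 0}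
  zero_mem' 𝔮 _ := ⟨1, (Ideal.ne_top_iff_one _).mp 𝔮.isPrime.ne_top, smul_zero _⟩
  add_mem' := by
    intro x y hx hy 𝔮 h𝔮
    obtain ⟨r, hr, hrx⟩ := hx 𝔮 h𝔮
    obtain ⟨t, ht, hty⟩ := hy 𝔮 h𝔮
    refine ⟨r * t, 𝔮.isPrime.mul_notMem hr ht, ?_⟩
    rw [smul_add, mul_comm, mul_smul, hrx, mul_comm, mul_smul, hty, smul_zero, smul_zero, add_zero]
  smul_mem' := by
    intro a x hx 𝔮 h𝔮
    obtain ⟨r, hr, hrx⟩ := hx 𝔮 h𝔮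
    exact ⟨r, hr, by rw [smul_comm, hrx, smul_zero]⟩

theorem mem_supportedOn {U : Set (PrimeSpectrum R)} {x : M} :
    x ∈ supportedOn M U ↔ ∀ 𝔮 ∉ U, ∃ r ∉ 𝔮.asIdeal, r • x = 0 :=
  Iff.rfl

theorem supportedOn_mono {U V : Set (PrimeSpectrum R)} (h : U ⊆ V) :
    supportedOn M U ≤ supportedOn M V :=
  fun _ hx 𝔮 h𝔮 => hx 𝔮 fun hU => h𝔮 (h hU)

theorem supportedOn_submoduleOf (U : Set (PrimeSpectrum R)) (N : Submodule R M) :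
    (supportedOn M U).submoduleOf N = supportedOn N U := by
  ext x
  simp only [Submodule.submoduleOf, Submodule.mem_comap, mem_supportedOn, Submodule.subtype_apply,
    Subtype.ext_iff, Submodule.coe_smul, Submodule.coe_zero]

theorem associatedPrimes_subset_union_submoduleOf {N L : Submodule R M} (h : N ≤ L) :
    associatedPrimes R L ⊆ associatedPrimes R N ∪ associatedPrimes R (L ⧸ N.submoduleOf L) := by
  rw [← LinearEquiv.AssociatedPrimes.eq (Submodule.submoduleOfEquivOfLe h)]
  exact associatedPrimes.subset_union_of_exact (Submodule.subtype_injective _)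
    (LinearMap.exact_subtype_mkQ _)

theorem associatedPrimes_quotient_subset_union {N L : Submodule R M} (h : N ≤ L) :
    associatedPrimes R (M ⧸ N) ⊆
      associatedPrimes R (L ⧸ N.submoduleOf L) ∪ associatedPrimes R (M ⧸ L) := by
  unfold Submodule.submoduleOf
  refine associatedPrimes.subset_union_of_exact
    (f := (N.comap L.subtype).mapQ N L.subtype le_rfl) (g := Submodule.factor h) ?_ ?_
  · rw [← LinearMap.ker_eq_bot, Submodule.ker_mapQ]
    exact Submodule.mkQ_map_self _
  · intro y
    obtain ⟨y, rfl⟩ := Submodule.mkQ_surjective N y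
    rw [Submodule.factor_mk, Submodule.mkQ_apply, Submodule.Quotient.mk_eq_zero]
    constructor
    · exact fun hy => ⟨Submodule.Quotient.mk ⟨y, hy⟩, rfl⟩
    · rintro ⟨z, hz⟩
      obtain ⟨z, rfl⟩ := Submodule.mkQ_surjective _ z
      have hz' : (z : M) - y ∈ N := (Submodule.Quotient.eq N).mp hz
      simpa using L.sub_mem z.2 (h hz')

variable [IsNoetherianRing R]

theorem PrimeSpectrum.asIdeal_mem_associatedPrimes {𝔭 : PrimeSpectrum R} :
    𝔭.asIdeal ∈ associatedPrimes R M ↔ ∃ x : M, ∀ r, r ∈ 𝔭.asIdeal ↔ r • x = 0 := by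
  simp [AssociatedPrimes.mem_iff, isAssociatedPrime_iff, 𝔭.isPrime, SetLike.ext_iff]

theorem PrimeSpectrum.asIdeal_mem_associatedPrimes_quotient {N : Submodule R M}
    {𝔭 : PrimeSpectrum R} :
    𝔭.asIdeal ∈ associatedPrimes R (M ⧸ N) ↔ ∃ x : M, ∀ r, r ∈ 𝔭.asIdeal ↔ r • x ∈ N := by
  rw [asIdeal_mem_associatedPrimes, (Submodule.mkQ_surjective N).exists]
  simp only [Submodule.mkQ_apply, ← Submodule.Quotient.mk_smul, Submodule.Quotient.mk_eq_zero]

theorem mem_associatedPrimes_supportedOn {U : Set (PrimeSpectrum R)} (hU : IsUpperSet U)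
    {𝔭 : PrimeSpectrum R} :
    𝔭.asIdeal ∈ associatedPrimes R (supportedOn M U) ↔
      𝔭.asIdeal ∈ associatedPrimes R M ∧ 𝔭 ∈ U := by
  refine ⟨fun h => ⟨associatedPrimes.subset_of_injective (Submodule.subtype_injective _) h, ?_⟩, ?_⟩
  · obtain ⟨x, hx⟩ := PrimeSpectrum.asIdeal_mem_associatedPrimes.mp h
    by_contra h𝔭
    obtain ⟨r, hr, hrx⟩ := x.2 𝔭 h𝔭
    exact hr ((hx r).mpr (Subtype.ext hrx))
  · rintro ⟨h, h𝔭⟩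
    obtain ⟨x, hx⟩ := PrimeSpectrum.asIdeal_mem_associatedPrimes.mp h
    refine PrimeSpectrum.asIdeal_mem_associatedPrimes.mpr ⟨⟨x, fun 𝔮 h𝔮 => ?_⟩, fun r => ?_⟩
    · obtain ⟨r, hr, hr𝔮⟩ := SetLike.not_le_iff_exists.mp fun hle : 𝔭.asIdeal ≤ 𝔮.asIdeal =>
        h𝔮 (hU hle h𝔭)
      exact ⟨r, hr𝔮, (hx r).mp hr⟩
    · simp [hx, Subtype.ext_iff]

/-- If `𝔭 = (Γ_U(M) : x)`, then `𝔭 ∉ U`, since otherwise `x` itself would be supported on `U`.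
Each of finitely many generators `a` of `𝔭` satisfies `a • x ∈ Γ_U(M)`, so one `s ∉ 𝔭` kills all
the `a • x`, and `𝔭` is the annihilator of `s • x`. -/
theorem mem_associatedPrimes_quotient_supportedOn {U : Set (PrimeSpectrum R)} (hU : IsUpperSet U)
    {𝔭 : PrimeSpectrum R} :
    𝔭.asIdeal ∈ associatedPrimes R (M ⧸ supportedOn M U) ↔
      𝔭.asIdeal ∈ associatedPrimes R M ∧ 𝔭 ∉ U := by
  constructor
  · intro h
    obtain ⟨x, hx⟩ := PrimeSpectrum.asIdeal_mem_associatedPrimes_quotient.mp h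
    have h𝔭 : 𝔭 ∉ U := by
      intro h𝔭
      refine 𝔭.isPrime.ne_top ((Ideal.eq_top_iff_one _).mpr ((hx 1).mpr ?_))
      rw [one_smul]
      intro 𝔮 h𝔮
      obtain ⟨a, ha, ha𝔮⟩ := SetLike.not_le_iff_exists.mp fun hle : 𝔭.asIdeal ≤ 𝔮.asIdeal =>
        h𝔮 (hU hle h𝔭)
      obtain ⟨b, hb, hbx⟩ := (hx a).mp ha 𝔮 h𝔮
      exact ⟨b * a, 𝔮.isPrime.mul_notMem hb ha𝔮, by rw [mul_smul, hbx]⟩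
    refine ⟨?_, h𝔭⟩
    obtain ⟨G, hG⟩ := (isNoetherianRing_iff_ideal_fg R).mp ‹_› 𝔭.asIdeal
    have key : ∀ a : R, ∃ s ∉ 𝔭.asIdeal, a ∈ 𝔭.asIdeal → s • a • x = 0 := by
      intro a
      by_cases ha : a ∈ 𝔭.asIdeal
      · obtain ⟨s, hs, hsx⟩ := (hx a).mp ha 𝔭 h𝔭
        exact ⟨s, hs, fun _ => hsx⟩
      · exact ⟨a, ha, fun h => absurd h ha⟩
    choose s hs hsx using key
    have ht : ∏ a ∈ G, s a ∉ 𝔭.asIdeal := by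
      rw [𝔭.isPrime.prod_mem_iff]
      rintro ⟨a, -, ha⟩
      exact hs a ha
    refine PrimeSpectrum.asIdeal_mem_associatedPrimes.mpr
      ⟨(∏ a ∈ G, s a) • x, fun r => ⟨fun hr => ?_, fun hr => ?_⟩⟩
    · have hle : 𝔭.asIdeal ≤ LinearMap.ker (LinearMap.toSpanSingleton R M ((∏ a ∈ G, s a) • x)) := by
        rw [← hG, Ideal.span_le]
        intro a ha
        have ha𝔭 : a ∈ 𝔭.asIdeal := hG ▸ Ideal.subset_span ha
        obtain ⟨c, hc⟩ := Finset.dvd_prod_of_mem s (Finset.mem_coe.mp ha)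
        rw [SetLike.mem_coe, LinearMap.mem_ker, LinearMap.toSpanSingleton_apply, smul_comm, hc,
          mul_comm, mul_smul, hsx a ha𝔭, smul_zero]
      simpa using hle hr
    · rw [← mul_smul] at hr
      have : r * ∏ a ∈ G, s a ∈ 𝔭.asIdeal := (hx _).mpr (hr ▸ Submodule.zero_mem _)
      exact (𝔭.isPrime.mem_or_mem this).resolve_right ht
  · rintro ⟨h, h𝔭⟩
    refine (associatedPrimes.subset_union_of_exact (Submodule.subtype_injective (supportedOn M U))
      (LinearMap.exact_subtype_mkQ _) h).resolve_left fun h' => ?_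
    exact h𝔭 ((mem_associatedPrimes_supportedOn hU).mp h').2

theorem eq_top_of_associatedPrimes_quotient {N : Submodule R M}
    (h : ∀ 𝔭 : PrimeSpectrum R, 𝔭.asIdeal ∉ associatedPrimes R (M ⧸ N)) : N = ⊤ := by
  by_contra hN
  have : Nontrivial (M ⧸ N) := Submodule.Quotient.nontrivial_iff.mpr hN
  obtain ⟨I, hI⟩ := associatedPrimes.nonempty R (M ⧸ N)
  exact h ⟨I, hI.isPrime⟩ hI

/-- For `N ≤ Γ_U(M)`: the quotient `N / Γ_U(N)` has no associated primes, so `N = Γ_U(N)`. For the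
converse: a nonzero class in `M / N` of an element of `Γ_U(M)` has its annihilator contained in an
associated prime of `M / N`, and that prime would have to lie in `U`. -/
theorem eq_supportedOn {U : Set (PrimeSpectrum R)} (hU : IsUpperSet U) {N : Submodule R M}
    (h₁ : ∀ 𝔭 : PrimeSpectrum R, 𝔭.asIdeal ∈ associatedPrimes R N → 𝔭 ∈ U)
    (h₂ : ∀ 𝔭 : PrimeSpectrum R, 𝔭.asIdeal ∈ associatedPrimes R (M ⧸ N) → 𝔭 ∉ U) :
    N = supportedOn M U := by
  apply le_antisymm
  · have htop : supportedOn N U = ⊤ := eq_top_of_associatedPrimes_quotient fun 𝔭 h𝔭 => by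
      obtain ⟨h, h'⟩ := (mem_associatedPrimes_quotient_supportedOn hU).mp h𝔭
      exact h' (h₁ 𝔭 h)
    rw [← supportedOn_submoduleOf] at htop
    exact Submodule.comap_subtype_eq_top.mp htop
  · intro x hx
    by_contra hxN
    obtain ⟨I, hI, hle⟩ := exists_le_isAssociatedPrime_of_isNoetherianRing R
      (Submodule.Quotient.mk x : M ⧸ N) (by rwa [Ne, Submodule.Quotient.mk_eq_zero])
    obtain ⟨r, hr, hrx⟩ := hx ⟨I, hI.isPrime⟩ (h₂ ⟨I, hI.isPrime⟩ hI)
    refine hr (hle ?_)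
    rw [Submodule.mem_colon_singleton, ← Submodule.Quotient.mk_smul, hrx]
    exact Submodule.zero_mem _

end SupportedOn

/-! ### Decreasing enumerations of finite sets -/

theorem Set.Finite.exists_strictAnti_range_eq {α : Type*} [LinearOrder α] {A : Set α}
    (hA : A.Finite) : ∃ (n : ℕ) (f : Fin n → α), StrictAnti f ∧ Set.range f = A := by
  refine ⟨hA.toFinset.card, hA.toFinset.orderEmbOfFin rfl ∘ Fin.rev,
    (OrderEmbedding.strictMono _).comp_strictAnti Fin.rev_strictAnti, ?_⟩
  rw [Fin.rev_surjective.range_comp, Finset.range_orderEmbOfFin, hA.coe_toFinset]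

theorem StrictAnti.fin_length_eq_of_range_eq {α : Type*} [LinearOrder α] {m n : ℕ}
    {f : Fin m → α} {g : Fin n → α} (hf : StrictAnti f) (hg : StrictAnti g)
    (h : Set.range f = Set.range g) : m = n := by
  rw [← Nat.card_fin m, ← Nat.card_fin n, ← Nat.card_range_of_injective hf.injective, h,
    Nat.card_range_of_injective hg.injective]

/-! ### Coprimary filtrations -/

section Filtration

variable {R : Type*} [CommRing R] {M : Type*} [AddCommGroup M] [Module R M]

/-- The primes that are at least `𝔭 j`, for the linear order `o`, for some `j < i`. The index `i`
ranges over `Fin (n + 1)`, as do the terms of a filtration with `n` quotients. -/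
def upperPrimes (o : LinearOrder (PrimeSpectrum R)) {n : ℕ} (𝔭 : Fin n → PrimeSpectrum R)
    (i : Fin (n + 1)) : Set (PrimeSpectrum R) :=
  {𝔮 | ∃ j : Fin n, j.castSucc < i ∧ o.le (𝔭 j) 𝔮}

theorem isUpperSet_upperPrimes {o : LinearOrder (PrimeSpectrum R)}
    (ho : ∀ 𝔭 𝔮 : PrimeSpectrum R, 𝔭.asIdeal ≤ 𝔮.asIdeal → o.le 𝔭 𝔮) {n : ℕ}
    (𝔭 : Fin n → PrimeSpectrum R) (i : Fin (n + 1)) : IsUpperSet (upperPrimes o 𝔭 i) := by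
  rintro 𝔮 𝔮' hle ⟨j, hj, hj𝔮⟩
  exact ⟨j, hj, o.le_trans _ _ _ hj𝔮 (ho _ _ hle)⟩

theorem mem_upperPrimes_iff {o : LinearOrder (PrimeSpectrum R)} {n : ℕ}
    {𝔭 : Fin n → PrimeSpectrum R} (h𝔭 : ∀ i j, i < j → o.lt (𝔭 j) (𝔭 i)) {i : Fin (n + 1)}
    {j : Fin n} : 𝔭 j ∈ upperPrimes o 𝔭 i ↔ j.castSucc < i := by
  refine ⟨?_, fun h => ⟨j, h, o.le_refl _⟩⟩
  rintro ⟨k, hk, hkj⟩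
  by_contra hij
  have hlt : k < j := Fin.castSucc_lt_castSucc_iff.mp (hk.trans_le (not_lt.mp hij))
  exact ((o.lt_iff_le_not_ge _ _).mp (h𝔭 k j hlt)).2 hkj

namespace IsCoprimaryFiltration

variable {o : LinearOrder (PrimeSpectrum R)} {s : LTSeries (Submodule R M)}
  {𝔭 : Fin s.length → PrimeSpectrum R}

theorem exists_of_mem_associatedPrimes (h : IsCoprimaryFiltration o s 𝔭) (i : Fin (s.length + 1))
    {I : Ideal R} (hI : I ∈ associatedPrimes R (s i)) :
    ∃ j : Fin s.length, j.castSucc < i ∧ (𝔭 j).asIdeal = I := by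
  induction i using Fin.induction with
  | zero =>
    have : Subsingleton (s 0) := (Submodule.subsingleton_iff_eq_bot).mpr h.head_eq_bot
    exact absurd hI not_isAssociatedPrime_of_subsingleton
  | succ i ih =>
    rcases associatedPrimes_subset_union_submoduleOf (s.step i).le hI with hI | hI
    · obtain ⟨j, hj, rfl⟩ := ih hI
      exact ⟨j, hj.trans Fin.castSucc_lt_succ, rfl⟩
    · have hi : associatedPrimes R _ = {(𝔭 i).asIdeal} := h.coprimary i
      rw [hi] at hI
      exact ⟨i, Fin.castSucc_lt_succ, hI.symm⟩

theorem exists_of_mem_associatedPrimes_quotient (h : IsCoprimaryFiltration o s 𝔭)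
    (i : Fin (s.length + 1)) {I : Ideal R} (hI : I ∈ associatedPrimes R (M ⧸ s i)) :
    ∃ j : Fin s.length, i ≤ j.castSucc ∧ (𝔭 j).asIdeal = I := by
  induction i using Fin.reverseInduction with
  | last =>
    have : Subsingleton (M ⧸ s (Fin.last s.length)) :=
      Submodule.Quotient.subsingleton_iff.mpr h.last_eq_top
    exact absurd hI not_isAssociatedPrime_of_subsingleton
  | cast i ih =>
    rcases associatedPrimes_quotient_subset_union (s.step i).le hI with hI | hI
    · have hi : associatedPrimes R _ = {(𝔭 i).asIdeal} := h.coprimary i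
      rw [hi] at hI
      exact ⟨i, le_rfl, hI.symm⟩
    · obtain ⟨j, hj, rfl⟩ := ih hI
      exact ⟨j, Fin.castSucc_lt_succ.le.trans hj, rfl⟩

variable [IsNoetherianRing R]

theorem eq_supportedOn (ho : ∀ 𝔭 𝔮 : PrimeSpectrum R, 𝔭.asIdeal ≤ 𝔮.asIdeal → o.le 𝔭 𝔮)
    (h : IsCoprimaryFiltration o s 𝔭) (i : Fin (s.length + 1)) :
    s i = supportedOn M (upperPrimes o 𝔭 i) := by
  refine _root_.eq_supportedOn (isUpperSet_upperPrimes ho 𝔭 i) (fun 𝔮 h𝔮 => ?_) fun 𝔮 h𝔮 => ?_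
  · obtain ⟨j, hj, hj𝔮⟩ := h.exists_of_mem_associatedPrimes i h𝔮
    rw [← PrimeSpectrum.ext hj𝔮]
    exact (mem_upperPrimes_iff h.strictAnti).mpr hj
  · obtain ⟨j, hj, hj𝔮⟩ := h.exists_of_mem_associatedPrimes_quotient i h𝔮
    rw [← PrimeSpectrum.ext hj𝔮, mem_upperPrimes_iff h.strictAnti]
    exact hj.not_gt

theorem associatedPrimes_eq_range
    (ho : ∀ 𝔭 𝔮 : PrimeSpectrum R, 𝔭.asIdeal ≤ 𝔮.asIdeal → o.le 𝔭 𝔮)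
    (h : IsCoprimaryFiltration o s 𝔭) :
    associatedPrimes R M = Set.range fun i => (𝔭 i).asIdeal := by
  apply subset_antisymm
  · intro I hI
    have hlast : s (Fin.last s.length) = ⊤ := h.last_eq_top
    rw [← LinearEquiv.AssociatedPrimes.eq Submodule.topEquiv, ← hlast] at hI
    obtain ⟨j, -, hj⟩ := h.exists_of_mem_associatedPrimes _ hI
    exact ⟨j, hj⟩
  · rintro _ ⟨i, rfl⟩
    have hi : associatedPrimes R _ = {(𝔭 i).asIdeal} := h.coprimary i
    rw [h.eq_supportedOn ho i.castSucc, supportedOn_submoduleOf] at hi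
    have hmem := hi.ge (Set.mem_singleton _)
    exact associatedPrimes.subset_of_injective (Submodule.subtype_injective _)
      ((mem_associatedPrimes_quotient_supportedOn (isUpperSet_upperPrimes ho 𝔭 _)).mp hmem).1

/-- The primes are the associated primes of `M` in decreasing order, and they determine the
terms of the filtration. -/
theorem unique (ho : ∀ 𝔭 𝔮 : PrimeSpectrum R, 𝔭.asIdeal ≤ 𝔮.asIdeal → o.le 𝔭 𝔮)
    {t : LTSeries (Submodule R M)} {𝔮 : Fin t.length → PrimeSpectrum R}
    (hs : IsCoprimaryFiltration o s 𝔭) (ht : IsCoprimaryFiltration o t 𝔮) : s = t := by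
  have hrange : Set.range 𝔭 = Set.range 𝔮 := by
    have himage := (hs.associatedPrimes_eq_range ho).symm.trans (ht.associatedPrimes_eq_range ho)
    have hinj : Function.Injective (PrimeSpectrum.asIdeal (R := R)) :=
      fun _ _ => PrimeSpectrum.ext
    refine Set.image_injective.mpr hinj ?_
    rwa [← Set.range_comp, ← Set.range_comp]
  have hlen : s.length = t.length :=
    @StrictAnti.fin_length_eq_of_range_eq _ o _ _ 𝔭 𝔮 hs.strictAnti ht.strictAnti hrange
  have hs' := hs.eq_supportedOn ho
  have ht' := ht.eq_supportedOn ho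
  have hs_anti := hs.strictAnti
  have ht_anti := ht.strictAnti
  -- The two filtrations can be identified componentwise once their lengths are.
  clear hs ht
  obtain ⟨m, f, hf⟩ := s
  obtain ⟨n, g, hg⟩ := t
  obtain rfl : m = n := hlen
  obtain rfl : 𝔭 = 𝔮 := (@StrictAnti.range_inj _ _ _ o.toPartialOrder.toPreorder _ _ _
    hs_anti ht_anti).mp hrange
  obtain rfl : f = g := funext fun i => (hs' i).trans (ht' i).symm
  rfl

end IsCoprimaryFiltration

variable [IsNoetherianRing R]

/-- For an enumeration `𝔭` of `Ass(M)` in decreasing order, the submodules `Γ_{U i}(M)` form a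
filtration. The `i`-th quotient is `𝔭 i`-coprimary since
`Ass(M) ∩ U (i + 1) \ U i = {𝔭 i}`, and this also makes the inclusions strict. -/
theorem exists_isCoprimaryFiltration [Module.Finite R M] {o : LinearOrder (PrimeSpectrum R)}
    (ho : ∀ 𝔭 𝔮 : PrimeSpectrum R, 𝔭.asIdeal ≤ 𝔮.asIdeal → o.le 𝔭 𝔮) :
    ∃ (s : LTSeries (Submodule R M)) (𝔭 : Fin s.length → PrimeSpectrum R),
      IsCoprimaryFiltration o s 𝔭 := by
  have hfin : {𝔭 : PrimeSpectrum R | 𝔭.asIdeal ∈ associatedPrimes R M}.Finite :=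
    (associatedPrimes.finite R M).preimage (fun _ _ _ _ => PrimeSpectrum.ext)
  obtain ⟨n, 𝔭, hanti, hrange⟩ := @Set.Finite.exists_strictAnti_range_eq _ o _ hfin
  have h𝔭 : ∀ i j, i < j → o.lt (𝔭 j) (𝔭 i) := fun i j hij => hanti hij
  have hmem : ∀ 𝔮 : PrimeSpectrum R, 𝔮.asIdeal ∈ associatedPrimes R M ↔ ∃ i, 𝔭 i = 𝔮 :=
    fun 𝔮 => (Set.ext_iff.mp hrange 𝔮).symm
  have hU := isUpperSet_upperPrimes ho 𝔭
  have hcop : ∀ i : Fin n, IsCoprimaryModule R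
      (supportedOn M (upperPrimes o 𝔭 i.succ) ⧸
        (supportedOn M (upperPrimes o 𝔭 i.castSucc)).submoduleOf
          (supportedOn M (upperPrimes o 𝔭 i.succ))) (𝔭 i) := by
    intro i
    rw [supportedOn_submoduleOf, IsCoprimaryModule]
    have hiff : ∀ 𝔮 : PrimeSpectrum R, 𝔮.asIdeal ∈ associatedPrimes R
        (supportedOn M (upperPrimes o 𝔭 i.succ) ⧸
          supportedOn (supportedOn M (upperPrimes o 𝔭 i.succ)) (upperPrimes o 𝔭 i.castSucc)) ↔
        𝔮 = 𝔭 i := by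
      intro 𝔮
      rw [mem_associatedPrimes_quotient_supportedOn (hU _),
        mem_associatedPrimes_supportedOn (hU _), hmem]
      constructor
      · rintro ⟨⟨⟨j, rfl⟩, hj⟩, hj'⟩
        rw [mem_upperPrimes_iff h𝔭] at hj hj'
        have hji : j = i := by
          simp only [Fin.lt_def, Fin.val_castSucc, Fin.val_succ] at hj hj'
          omega
        rw [hji]
      · rintro rfl
        exact ⟨⟨⟨i, rfl⟩, (mem_upperPrimes_iff h𝔭).mpr Fin.castSucc_lt_succ⟩,
          fun h => lt_irrefl _ ((mem_upperPrimes_iff h𝔭).mp h)⟩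
    ext I
    constructor
    · intro hI
      exact congrArg PrimeSpectrum.asIdeal ((hiff ⟨I, hI.isPrime⟩).mp hI)
    · rintro rfl
      exact (hiff (𝔭 i)).mpr rfl
  let s : LTSeries (Submodule R M) :=
    { length := n
      toFun := fun i => supportedOn M (upperPrimes o 𝔭 i)
      step := fun i => by
        refine lt_of_le_not_ge (supportedOn_mono ?_) fun hle => ?_
        · rintro 𝔮 ⟨j, hj, hj𝔮⟩
          exact ⟨j, hj.trans Fin.castSucc_lt_succ, hj𝔮⟩
        · have : Subsingleton (supportedOn M (upperPrimes o 𝔭 i.succ) ⧸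
              (supportedOn M (upperPrimes o 𝔭 i.castSucc)).submoduleOf
                (supportedOn M (upperPrimes o 𝔭 i.succ))) :=
            Submodule.Quotient.subsingleton_iff.mpr (Submodule.comap_subtype_eq_top.mpr hle)
          have hi : associatedPrimes R _ = {(𝔭 i).asIdeal} := hcop i
          exact not_isAssociatedPrime_of_subsingleton (hi.ge (Set.mem_singleton _)) }
  refine ⟨s, 𝔭, ?_, ?_, hcop, h𝔭⟩
  · symm
    refine eq_supportedOn (hU 0) (fun 𝔮 h𝔮 => ?_) ?_
    · exact absurd h𝔮 not_isAssociatedPrime_of_subsingleton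
    · rintro 𝔮 - ⟨j, hj, -⟩
      exact absurd hj (Fin.not_lt_zero _)
  · refine eq_top_of_associatedPrimes_quotient fun 𝔮 h𝔮 => ?_
    obtain ⟨h, h'⟩ := (mem_associatedPrimes_quotient_supportedOn (hU (Fin.last n))).mp h𝔮
    obtain ⟨j, rfl⟩ := (hmem 𝔮).mp h
    exact h' ((mem_upperPrimes_iff h𝔭).mpr (Fin.castSucc_lt_last j))

end Filtration

theorem theorem5p3 {R : Type*} [CommRing R] [IsNoetherianRing R]
    {M : Type*} [AddCommGroup M] [Module R M] [Module.Finite R M]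
    (o : LinearOrder (PrimeSpectrum R))
    (ho : ∀ 𝔭 𝔮 : PrimeSpectrum R, 𝔭.asIdeal ≤ 𝔮.asIdeal → o.le 𝔭 𝔮) :
    (∃! s : LTSeries (Submodule R M),
      ∃ 𝔭 : Fin s.length → PrimeSpectrum R, IsCoprimaryFiltration o s 𝔭) ∧
    (∀ (s : LTSeries (Submodule R M)) (𝔭 : Fin s.length → PrimeSpectrum R),
      IsCoprimaryFiltration o s 𝔭 →
        associatedPrimes R M = Set.range fun i => (𝔭 i).asIdeal) := by
  refine ⟨?_, fun s 𝔭 h => h.associatedPrimes_eq_range ho⟩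
  obtain ⟨s, 𝔭, h⟩ := exists_isCoprimaryFiltration (M := M) ho
  exact ⟨s, ⟨𝔭, h⟩, fun t ⟨_, ht⟩ => ht.unique ho h⟩
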